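/- Let $k\ge 0$ and $N\ge 2k$ be integers, and let $P_k(N)$ be the complex partition algebra: the vector space with basis $d_\pi$, $\pi$ running over the set partitions of $\{1,\dots,k,1',\dots,k'\}$, with product $d_\pi d_{\pi'}=N^{c}d_{\pi''}$, where $\pi$ is stacked above $\pi'$, the bottom vertices $a$ of $\pi$ are identified with the top vertices $a'$ of $\pi'$, $\pi''$ is the induced partition of the outer vertices, and $c$ is the number of connected components contained in the middle row. Let $d\mapsto d^T$ be the linear map exchanging primed and unprimed vertices. Let $V_N=\mathbb C^N$, and for $d\in P_k(N)$ let $D\in\operatorname{End}(V_N^{\otimes k})$ be the corresponding map, depending linearly on $d$, where $d_\pi\mapsto D_\pi$ and $(D_\pi)^{i_{1'}\dots i_{k'}}_{i_1\dots i_k}=1$ if $i_a=i_b$ whenever $a,b$ lie in the same block of $\pi$, and $0$ otherwise. For a matrix representation $D^\lambda$ of $P_k(N)$ on $Z_\lambda=\mathbb C^{m_\lambda}$ put $V_\lambda=\operatorname{Hom}_{P_k(N)}(Z_\lambda,V_N^{\otimes k})$, with the action of $S_N$ induced by the diagonal action on $V_N^{\otimes k}$ (so that $V_\lambda$ is paired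 with $Z_\lambda$ in the Schur--Weyl decomposition $V_N^{\otimes k}\cong\bigoplus_\lambda V_\lambda\otimes Z_\lambda$). Then the bilinear form $\langle d,d'\rangle=\operatorname{Tr}_{V_N^{\otimes k}}(D\,D'^{T})$ on $P_k(N)$ is non-degenerate. Let $(b_i)$ be any basis of $P_k(N)$ with corresponding maps $B_i$, let $g_{ij}=\operatorname{Tr}_{V_N^{\otimes k}}(B_iB_j)$ and $b_i^\dagger=\sum_j (g^{-1})_{ji}\,b_j^T$; then $\langle b_i,b_j^\dagger\rangle=\delta_{ij}$. Let $(D^\lambda)_{\lambda\in\Lambda}$ be pairwise non-isomorphic irreducible (unital) matrix representations of $P_k(N)$, written in orthonormal bases, i.e. such that $D^\lambda(d^T)=D^\lambda(d)^T$ for all $d\in P_k(N)$. Then each $V_\lambda$ is an irreducible representation of $S_N$, and for all $\lambda,\lambda'\in\Lambda$ and all indices $\alpha,\beta$ of $D^\lambda$ and $\rho,\sigma$ of $D^{\lambda'}$, $$\sum_i D^{\lambda}_{\alpha\beta}(b_i)\,D^{\lambda'}_{\rho\sigma}(b_i^\dagger)=\frac{1}{\dim V_\lambda}\,\delta_{\alpha\rho}\,\delta_{\beta\sigma}\,\delta^{\lambda\lambda'}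 .$$ -/

import Mathlib

open scoped TensorProduct

noncomputable section

namespace PartitionAlg

/-! ### Partition diagrams -/

/-- A partition diagram on `k` strands: a set partition of `{1, …, k, 1', …, k'}`, encoded as an
equivalence relation. `Sum.inl a` is the bottom vertex `a`, `Sum.inr a` is the top vertex `a'`. -/
abbrev Diagram (k : ℕ) : Type := Setoid (Fin k ⊕ Fin k)

namespace Diagram

variable {k : ℕ}

/-- The three rows of vertices of a stack of two diagrams: bottom, middle and top. -/
abbrev Rows (k : ℕ) : Type := Fin k ⊕ (Fin k ⊕ Fin k)

/-- The upper diagram of a stack occupies the middle row (its bottom) and the top row. -/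
def upper : Fin k ⊕ Fin k → Rows k := Sum.inr

/-- The lower diagram of a stack occupies the bottom row and the middle row (its top). -/
def lower : Fin k ⊕ Fin k → Rows k :=
  Sum.elim Sum.inl (fun a => Sum.inr (Sum.inl a))

/-- The bottom and the top row of a stack. -/
def outer : Fin k ⊕ Fin k → Rows k :=
  Sum.elim Sum.inl (fun a => Sum.inr (Sum.inr a))

/-- Connected components of the stack obtained by placing `p` above `q` and identifying the bottom
vertices of `p` with the top vertices of `q`. -/
abbrev stack (p q : Diagram k) : Setoid (Rows k) :=
  p.map upper ⊔ q.map lower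

/-- The diagram obtained from the stack by forgetting the middle row. -/
abbrev comp (p q : Diagram k) : Diagram k :=
  (stack p q).comap outer

/-- The number of connected components of the stack that lie entirely within the middle row. -/
def loops (p q : Diagram k) : ℕ :=
  Nat.card {c : Quotient (stack p q) //
    ∀ x : Fin k ⊕ Fin k, (Quotient.mk (stack p q) (outer x)) ≠ c}

/-- The identity diagram `11' | 22' | ⋯ | kk'`. -/
abbrev one (k : ℕ) : Diagram k :=
  Setoid.ker (Sum.elim id id : Fin k ⊕ Fin k → Fin k)

/-- The reflected diagram, with primed and unprimed vertices exchanged. -/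
abbrev transpose (p : Diagram k) : Diagram k :=
  p.comap Sum.swap

end Diagram

/-! ### The partition algebra -/

/-- The complex vector space underlying the partition algebra `P_k(N)`, with basis the partition
diagrams. The parameter `N` only enters the multiplication. -/
def PartitionAlgebra (k _N : ℕ) : Type := Diagram k →₀ ℂ

namespace PartitionAlgebra

variable {k N : ℕ}

instance : AddCommGroup (PartitionAlgebra k N) :=
  inferInstanceAs (AddCommGroup (Diagram k →₀ ℂ))

instance : Module ℂ (PartitionAlgebra k N) :=
  inferInstanceAs (Module ℂ (Diagram k →₀ ℂ))

/-- The diagram basis `d_π`. -/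
def diagramBasis (k N : ℕ) : Module.Basis (Diagram k) ℂ (PartitionAlgebra k N) :=
  Module.Basis.ofRepr (LinearEquiv.refl ℂ (Diagram k →₀ ℂ))

/-- The bilinear multiplication with `d_p d_q = N ^ c • d_{p ∘ q}`, where `c` is the number of
components removed from the middle row. -/
def mulBilin (k N : ℕ) :
    PartitionAlgebra k N →ₗ[ℂ] PartitionAlgebra k N →ₗ[ℂ] PartitionAlgebra k N :=
  (diagramBasis k N).constr ℂ fun p =>
    (diagramBasis k N).constr ℂ fun q =>
      ((N : ℂ) ^ Diagram.loops p q) • diagramBasis k N (Diagram.comp p q)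

instance : Mul (PartitionAlgebra k N) := ⟨fun x y => mulBilin k N x y⟩

instance : One (PartitionAlgebra k N) := ⟨diagramBasis k N (Diagram.one k)⟩

/-- The transpose `d ↦ dᵀ`, the linear extension of the reflection of diagrams. -/
def transpose (k N : ℕ) : PartitionAlgebra k N →ₗ[ℂ] PartitionAlgebra k N :=
  (diagramBasis k N).constr ℂ fun p => diagramBasis k N (Diagram.transpose p)

end PartitionAlgebra

/-! ### The tensor power `V_N^{⊗k}` -/

/-- The tensor power `V_N^{⊗k}` of `V_N = ℂ^N`. -/
def TensorSpace (k N : ℕ) : Type := ⨂[ℂ] _ : Fin k, (Fin N → ℂ)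

instance (k N : ℕ) : AddCommGroup (TensorSpace k N) :=
  inferInstanceAs (AddCommGroup (⨂[ℂ] _ : Fin k, (Fin N → ℂ)))

instance (k N : ℕ) : Module ℂ (TensorSpace k N) :=
  inferInstanceAs (Module ℂ (⨂[ℂ] _ : Fin k, (Fin N → ℂ)))

/-- The basis `e_{i_1} ⊗ ⋯ ⊗ e_{i_k}` of `V_N^{⊗k}`. -/
def tensorBasis (k N : ℕ) : Module.Basis (Fin k → Fin N) ℂ (TensorSpace k N) :=
  Basis.piTensorProduct (fun _ : Fin k => Pi.basisFun ℂ (Fin N))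

open Classical in
/-- The matrix of `D_π`: the entry in row `j = (i_{1'}, …, i_{k'})` and column
`i = (i_1, …, i_k)` is `1` if the indices are equal whenever their vertices lie in the same block
of `π`, and `0` otherwise. -/
def diagramMatrix {k : ℕ} (N : ℕ) (p : Diagram k) :
    Matrix (Fin k → Fin N) (Fin k → Fin N) ℂ :=
  Matrix.of fun j i => if ∀ a b, p a b → Sum.elim i j a = Sum.elim i j b then 1 else 0

/-- The linear map `d ↦ D` from `P_k(N)` to the endomorphisms of `V_N^{⊗k}`, `d_π ↦ D_π`. -/
def toEnd (k N : ℕ) : PartitionAlgebra k N →ₗ[ℂ] Module.End ℂ (TensorSpace k N) :=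
  (PartitionAlgebra.diagramBasis k N).constr ℂ fun p =>
    Matrix.toLin (tensorBasis k N) (tensorBasis k N) (diagramMatrix N p)

/-- The transpose of an endomorphism of `V_N^{⊗k}` in the basis `e_{i_1} ⊗ ⋯ ⊗ e_{i_k}`. -/
def transposeEnd (k N : ℕ) :
    Module.End ℂ (TensorSpace k N) →ₗ[ℂ] Module.End ℂ (TensorSpace k N) :=
  (Matrix.toLin (tensorBasis k N) (tensorBasis k N)).toLinearMap ∘ₗ
    (Matrix.transposeLinearEquiv (Fin k → Fin N) (Fin k → Fin N) ℂ ℂ).toLinearMap ∘ₗ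
      (LinearMap.toMatrix (tensorBasis k N) (tensorBasis k N)).toLinearMap

/-- The bilinear form `⟨d, d'⟩ = Tr_{V_N^{⊗k}}(D D'ᵀ)` on `P_k(N)`. -/
def traceForm (k N : ℕ) : LinearMap.BilinForm ℂ (PartitionAlgebra k N) :=
  ((LinearMap.mul ℂ (Module.End ℂ (TensorSpace k N))).compl₁₂
    (toEnd k N) (transposeEnd k N ∘ₗ toEnd k N)).compr₂ (LinearMap.trace ℂ (TensorSpace k N))

section Dual

variable {k N : ℕ} {ι : Type*} [Fintype ι] [DecidableEq ι]

/-- The matrix `g_{ij} = Tr_{V_N^{⊗k}}(B_i B_j)` of a basis `b` of `P_k(N)`. -/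
def gram (b : Module.Basis ι ℂ (PartitionAlgebra k N)) : Matrix ι ι ℂ :=
  Matrix.of fun i j =>
    LinearMap.trace ℂ (TensorSpace k N) (toEnd k N (b i) * toEnd k N (b j))

/-- The dual elements `b_i^† = ∑_j (g⁻¹)_{ji} b_jᵀ`. -/
def dual (b : Module.Basis ι ℂ (PartitionAlgebra k N)) (i : ι) : PartitionAlgebra k N :=
  ∑ j, (gram b)⁻¹ j i • PartitionAlgebra.transpose k N (b j)

end Dual

/-! ### Matrix representations of the partition algebra -/

/-- A (unital) matrix representation of `P_k(N)` of dimension `m`. -/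
structure MatrixRep (k N m : ℕ) where
  toLin : PartitionAlgebra k N →ₗ[ℂ] Matrix (Fin m) (Fin m) ℂ
  map_one : toLin 1 = 1
  map_mul : ∀ x y, toLin (x * y) = toLin x * toLin y

namespace MatrixRep

variable {k N m m' : ℕ}

instance : CoeFun (MatrixRep k N m)
    (fun _ => PartitionAlgebra k N → Matrix (Fin m) (Fin m) ℂ) := ⟨fun D => D.toLin⟩

/-- `D` is irreducible: it is nonzero and `ℂ^m` has no proper nonzero invariant subspace. -/
def IsIrreducible (D : MatrixRep k N m) : Prop :=
  0 < m ∧ ∀ W : Submodule ℂ (Fin m → ℂ),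
    (∀ d, ∀ w ∈ W, Matrix.mulVec (D d) w ∈ W) → W = ⊥ ∨ W = ⊤

/-- `D` is written in an orthonormal basis: the transpose of `P_k(N)` goes to the transpose of
matrices, i.e. the standard bilinear form on `ℂ^m` satisfies `(d v, w) = (v, dᵀ w)`, as the
standard bilinear form of `V_N^{⊗k}` does. -/
def IsOrthogonal (D : MatrixRep k N m) : Prop :=
  ∀ d, D (PartitionAlgebra.transpose k N d) = (D d).transpose

/-- Isomorphism of matrix representations. -/
def Isomorphic (D : MatrixRep k N m) (D' : MatrixRep k N m') : Prop :=
  ∃ T : (Fin m → ℂ) ≃ₗ[ℂ] (Fin m' → ℂ),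
    ∀ d v, T (Matrix.mulVec (D d) v) = Matrix.mulVec (D' d) (T v)

end MatrixRep

/-! ### The symmetric group and the Schur-Weyl partner of a representation -/

/-- The diagonal action of `S_N` on `V_N^{⊗k}`, with `σ e_i = e_{σ i}` on `V_N`. -/
def permRep (k N : ℕ) : Representation ℂ (Equiv.Perm (Fin N)) (TensorSpace k N) where
  toFun σ := PiTensorProduct.map fun _ => LinearMap.funLeft ℂ ℂ σ.symm
  map_one' := PiTensorProduct.map_id
  map_mul' σ τ :=
    PiTensorProduct.map_mul (R := ℂ) (fun _ : Fin k => LinearMap.funLeft ℂ ℂ σ.symm)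
      (fun _ => LinearMap.funLeft ℂ ℂ τ.symm)

theorem permRep_tensorBasis (k N : ℕ) (σ : Equiv.Perm (Fin N)) (i : Fin k → Fin N) :
    permRep k N σ (tensorBasis k N i) = tensorBasis k N (σ ∘ i) := by
  have h : PiTensorProduct.map (fun _ : Fin k => LinearMap.funLeft ℂ ℂ σ.symm)
      (Basis.piTensorProduct (fun _ : Fin k => Pi.basisFun ℂ (Fin N)) i) =
      Basis.piTensorProduct (fun _ : Fin k => Pi.basisFun ℂ (Fin N)) (σ ∘ i) := by
    rw [Basis.piTensorProduct_apply, Basis.piTensorProduct_apply, PiTensorProduct.map_tprod]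
    refine congrArg (PiTensorProduct.tprod ℂ) ?_
    funext a
    ext j
    simp [LinearMap.funLeft_apply, Pi.single_apply, Equiv.symm_apply_eq]
  exact h

theorem diagramMatrix_perm {k N : ℕ} (p : Diagram k) (σ : Equiv.Perm (Fin N))
    (j i : Fin k → Fin N) :
    diagramMatrix N p (σ ∘ j) (σ ∘ i) = diagramMatrix N p j i := by
  have h : ∀ x, Sum.elim (σ ∘ i) (σ ∘ j) x = σ (Sum.elim i j x) := by
    intro x
    cases x <;> rfl
  have h2 : (∀ a b, p a b → Sum.elim (σ ∘ i) (σ ∘ j) a = Sum.elim (σ ∘ i) (σ ∘ j) b) ↔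
      ∀ a b, p a b → Sum.elim i j a = Sum.elim i j b := by
    refine forall_congr' fun a => forall_congr' fun b => imp_congr_right fun _ => ?_
    rw [h, h]
    exact σ.injective.eq_iff
  simp only [diagramMatrix, Matrix.of_apply]
  classical exact if_congr h2 rfl rfl

/-- The actions of `P_k(N)` and `S_N` on `V_N^{⊗k}` commute. -/
theorem toEnd_comm_permRep (k N : ℕ) (d : PartitionAlgebra k N) (σ : Equiv.Perm (Fin N)) :
    toEnd k N d ∘ₗ permRep k N σ = permRep k N σ ∘ₗ toEnd k N d := by
  have key : (LinearMap.lcomp ℂ _ (permRep k N σ)) ∘ₗ toEnd k N =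
      (LinearMap.compRight ℂ (permRep k N σ)) ∘ₗ toEnd k N := by
    refine (PartitionAlgebra.diagramBasis k N).ext fun p => ?_
    refine (tensorBasis k N).ext fun i => ?_
    simp only [LinearMap.comp_apply, LinearMap.lcomp_apply, LinearMap.compRight_apply, toEnd,
      Module.Basis.constr_basis, permRep_tensorBasis, Matrix.toLin_self, map_sum, map_smul]
    rw [← (Equiv.arrowCongr (Equiv.refl (Fin k)) σ).sum_comp]
    refine Finset.sum_congr rfl fun j _ => ?_
    have hj : (Equiv.arrowCongr (Equiv.refl (Fin k)) σ) j = σ ∘ j := rfl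
    rw [hj, diagramMatrix_perm]
  exact LinearMap.congr_fun key d

variable {k N m : ℕ}

/-- The space `V_λ = Hom_{P_k(N)}(Z_λ, V_N^{⊗k})` paired with `Z_λ = ℂ^m` (on which `P_k(N)` acts
through `D`) in the decomposition `V_N^{⊗k} ≅ ⨁_λ V_λ ⊗ Z_λ`. -/
def partner (D : MatrixRep k N m) : Submodule ℂ ((Fin m → ℂ) →ₗ[ℂ] TensorSpace k N) where
  carrier := {f | ∀ d z, f (Matrix.mulVec (D d) z) = toEnd k N d (f z)}
  add_mem' hf hg d z := by simp [hf d z, hg d z]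
  zero_mem' d z := by simp
  smul_mem' c f hf d z := by simp [hf d z]

theorem partner_perm (D : MatrixRep k N m) (σ : Equiv.Perm (Fin N))
    (f : (Fin m → ℂ) →ₗ[ℂ] TensorSpace k N) (hf : f ∈ partner D) :
    permRep k N σ ∘ₗ f ∈ partner D := by
  intro d z
  have h := LinearMap.congr_fun (toEnd_comm_permRep k N d σ) (f z)
  simp only [LinearMap.comp_apply] at h ⊢
  rw [hf d z, h]

/-- The action of `S_N` on `V_λ = Hom_{P_k(N)}(Z_λ, V_N^{⊗k})` induced by the one on
`V_N^{⊗k}`. -/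
def partnerRep (D : MatrixRep k N m) : Representation ℂ (Equiv.Perm (Fin N)) (partner D) where
  toFun σ := LinearMap.restrict (LinearMap.compRight ℂ (permRep k N σ))
    (fun f hf => partner_perm D σ f hf)
  map_one' := by
    refine LinearMap.ext fun f => Subtype.ext (LinearMap.ext fun z => ?_)
    change permRep k N 1 (f.1 z) = f.1 z
    rw [map_one, Module.End.one_apply]
  map_mul' σ τ := by
    refine LinearMap.ext fun f => Subtype.ext (LinearMap.ext fun z => ?_)
    change permRep k N (σ * τ) (f.1 z) = permRep k N σ (permRep k N τ (f.1 z))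
    rw [map_mul, Module.End.mul_apply]

end PartitionAlg

end

noncomputable section

namespace PartitionAlg

open Matrix

variable {k N m m' : ℕ}

/-! The $(j,i)$ entry of $D$ is the sum of the coefficients of $d$ over the diagrams refining the
kernel of the labelling $(i,j)$. This zeta transform is unitriangular, hence bijective. So the
matrices $D$ are exactly those invariant under relabelling by $S_N$ (`exists_toMat_eq`), and
$d\mapsto D$ is injective once every partition is a kernel, which is ensured by $N\ge 2k$. The image
is closed under complex conjugation, so positivity of $\operatorname{Tr}(XX^*)$ gives
non-degeneracy.

Let $E_{\alpha\beta}=\sum_i D^\lambda_{\alpha\beta}(b_i)\,b_i^\dagger$, which represents the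
functional $D^\lambda_{\alpha\beta}$ for the form. Adjointness of multiplication makes the
$E_{\alpha\beta}$ transform like matrix units on both sides (`mul_coeffElem`, `coeffElem_mul`).
Schur's lemma, applied on each side, then gives all the Kronecker deltas and one unknown scalar $c$.

The scalar comes from a trace: $E_{\alpha\alpha}$ has trace $D^\lambda_{\alpha\alpha}(1)=1$ on
$V_N^{\otimes k}$ and satisfies $E_{\alpha\alpha}^2=cE_{\alpha\alpha}$. So $c^{-1}E_{\alpha\alpha}$
is a projection of rank $c^{-1}$, and its range is $V_\lambda$ by evaluation at $e_\alpha$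
(`coeff_mul_finrank_partner`). Irreducibility of $V_\lambda$ follows from Maschke averaging, since
an $S_N$-equivariant projection comes from $P_k(N)$. -/

instance : Finite (Diagram k) :=
  Finite.of_injective (fun p : Diagram k => fun x : (Fin k ⊕ Fin k) × (Fin k ⊕ Fin k) => p x.1 x.2)
    fun _ _ h => Setoid.ext fun a b => Iff.of_eq (congrFun h (a, b))

instance : Fintype (Diagram k) := Fintype.ofFinite _

instance : Module.Finite ℂ (PartitionAlgebra k N) :=
  Module.Finite.of_basis (PartitionAlgebra.diagramBasis k N)

instance : Module.Finite ℂ (TensorSpace k N) := Module.Finite.of_basis (tensorBasis k N)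

/-! ### The matrix of `d` on the tensor power -/

/-- The matrix of `D` in the standard basis of `V_N^{⊗k}`. -/
def toMat (k N : ℕ) :
    PartitionAlgebra k N →ₗ[ℂ] Matrix (Fin k → Fin N) (Fin k → Fin N) ℂ :=
  (LinearMap.toMatrix (tensorBasis k N) (tensorBasis k N)).toLinearMap ∘ₗ toEnd k N

theorem toMat_basis (p : Diagram k) :
    toMat k N (PartitionAlgebra.diagramBasis k N p) = diagramMatrix N p := by
  rw [toMat, LinearMap.comp_apply, toEnd, Module.Basis.constr_basis]
  exact LinearMap.toMatrix_toLin _ _ _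

theorem toLin_toMat (d : PartitionAlgebra k N) :
    Matrix.toLin (tensorBasis k N) (tensorBasis k N) (toMat k N d) = toEnd k N d := by
  simp [toMat]

open Classical in
theorem diagramMatrix_apply (p : Diagram k) (j i : Fin k → Fin N) :
    diagramMatrix N p j i = if p ≤ Setoid.ker (Sum.elim i j) then 1 else 0 := by
  simp only [diagramMatrix, Matrix.of_apply]
  exact if_congr Iff.rfl rfl rfl

theorem mul_basis (p q : Diagram k) :
    PartitionAlgebra.diagramBasis k N p * PartitionAlgebra.diagramBasis k N q =
      ((N : ℂ) ^ Diagram.loops p q) • PartitionAlgebra.diagramBasis k N (Diagram.comp p q) := by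
  change PartitionAlgebra.mulBilin k N _ _ = _
  rw [PartitionAlgebra.mulBilin, Module.Basis.constr_basis, Module.Basis.constr_basis]

theorem transpose_basis (p : Diagram k) :
    PartitionAlgebra.transpose k N (PartitionAlgebra.diagramBasis k N p) =
      PartitionAlgebra.diagramBasis k N (Diagram.transpose p) := by
  rw [PartitionAlgebra.transpose, Module.Basis.constr_basis]

/-- The number of extensions of a function from the range of `f`. -/
theorem card_extensions {X Q S : Type*} [Finite Q] (f : X → Q) (g : X → S)
    (h : ∀ a b, f a = f b → g a = g b) :
    Nat.card {φ : Q → S // φ ∘ f = g} = Nat.card S ^ Nat.card {c : Q // ∀ x, f x ≠ c} := by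
  classical
  have := Fintype.ofFinite Q
  have e : {φ : Q → S // φ ∘ f = g} ≃ ({c : Q // ∀ x, f x ≠ c} → S) :=
    { toFun := fun φ c => φ.1 c.1
      invFun := fun ψ => ⟨fun c => if hc : ∀ x, f x ≠ c then ψ ⟨c, hc⟩ else
          g (not_forall.1 hc).choose, by
        funext x
        have hx : ¬ ∀ y, f y ≠ f x := fun hc => hc x rfl
        simp only [Function.comp_apply, dif_neg hx]
        exact h _ _ (not_not.1 (not_forall.1 hx).choose_spec)⟩
      left_inv := by
        rintro ⟨φ, rfl⟩
        refine Subtype.ext (funext fun c => ?_)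
        by_cases hc : ∀ x, f x ≠ c
        · simp only [dif_pos hc]
        · simp only [dif_neg hc, Function.comp_apply]
          exact congrArg φ (not_not.1 (not_forall.1 hc).choose_spec)
      right_inv := fun ψ => funext fun c => by simp only [dif_pos c.2] }
  rw [Nat.card_congr e, Nat.card_fun]

theorem map_le_iff_le_comap {X Y : Type*} (r : Setoid X) (f : X → Y) (s : Setoid Y) :
    r.map f ≤ s ↔ r ≤ s.comap f :=
  ⟨fun h => Setoid.le_comap_map.trans fun _ _ hab => h hab,
    fun h => Setoid.eqvGen_le fun _ _ ⟨_, _, hxy, hx, hy⟩ => by subst hx hy; exact h hxy⟩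

theorem stack_le_ker_iff (p q : Diagram k) (i j l : Fin k → Fin N) :
    Diagram.stack p q ≤ Setoid.ker (Sum.elim i (Sum.elim l j)) ↔
      p ≤ Setoid.ker (Sum.elim l j) ∧ q ≤ Setoid.ker (Sum.elim i l) := by
  have hl : Setoid.comap Diagram.lower (Setoid.ker (Sum.elim i (Sum.elim l j))) =
      Setoid.ker (Sum.elim i l) := by
    ext a b
    cases a <;> cases b <;> rfl
  rw [sup_le_iff, map_le_iff_le_comap, map_le_iff_le_comap, hl]
  rfl

/-- The number of labellings of the middle row compatible with both diagrams of a stack. -/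
theorem card_middle (p q : Diagram k) (i j : Fin k → Fin N)
    (h : Diagram.comp p q ≤ Setoid.ker (Sum.elim i j)) :
    Nat.card {l : Fin k → Fin N // p ≤ Setoid.ker (Sum.elim l j) ∧
      q ≤ Setoid.ker (Sum.elim i l)} = N ^ Diagram.loops p q := by
  rw [Diagram.loops]
  -- Compatible middle labellings are the functions on the components of the stack with prescribed
  -- values on those meeting an outer row; the free components are the loops.
  have := card_extensions (S := Fin N)
    (fun x => (Quotient.mk (Diagram.stack p q) (Diagram.outer x))) (Sum.elim i j)
    (fun a b hab => @h a b (Quotient.exact (s := Diagram.stack p q) hab))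
  rw [Nat.card_fin] at this
  rw [← this]
  have key (l : Fin k → Fin N) := stack_le_ker_iff p q i j l
  refine Nat.card_congr
    { toFun := fun l => ⟨Quotient.lift (Sum.elim i (Sum.elim l.1 j))
        (fun a b hab => (key l.1).2 l.2 hab), by funext x; cases x <;> rfl⟩
      invFun := fun φ => ⟨fun a => φ.1 (Quotient.mk _ (Sum.inr (Sum.inl a))), (key _).1 ?_⟩
      left_inv := fun l => rfl
      right_inv := ?_ }
  · have hφ : Sum.elim i (Sum.elim (fun a => φ.1 (Quotient.mk _ (Sum.inr (Sum.inl a)))) j) =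
        fun x => φ.1 (Quotient.mk _ x) := by
      funext x
      rcases x with a | a | a
      · exact (congrFun φ.2 (Sum.inl a)).symm
      · rfl
      · exact (congrFun φ.2 (Sum.inr a)).symm
    rw [hφ]
    intro a b hab
    exact congrArg φ.1 (Quotient.sound hab)
  · intro φ
    refine Subtype.ext (funext fun c => ?_)
    induction c using Quotient.inductionOn with | _ x =>
    rcases x with a | a | a
    · exact (congrFun φ.2 (Sum.inl a)).symm
    · rfl
    · exact (congrFun φ.2 (Sum.inr a)).symm

theorem comp_le_ker (p q : Diagram k) (i j l : Fin k → Fin N)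
    (hp : p ≤ Setoid.ker (Sum.elim l j)) (hq : q ≤ Setoid.ker (Sum.elim i l)) :
    Diagram.comp p q ≤ Setoid.ker (Sum.elim i j) := by
  have hs := (stack_le_ker_iff p q i j l).2 ⟨hp, hq⟩
  intro a b hab
  have := hs hab
  cases a <;> cases b <;> exact this

/-- The matrix product sums over labellings of the middle row. Those compatible with both diagrams
number $N^{c}$ if the outer labelling respects the composite, and there are none otherwise. -/
theorem diagramMatrix_mul (p q : Diagram k) :
    diagramMatrix N p * diagramMatrix N q =
      ((N : ℂ) ^ Diagram.loops p q) • diagramMatrix N (Diagram.comp p q) := by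
  classical
  ext j i
  simp only [Matrix.mul_apply, Matrix.smul_apply, diagramMatrix_apply, smul_eq_mul, mul_ite,
    mul_one, mul_zero, ← ite_and]
  by_cases h : Diagram.comp p q ≤ Setoid.ker (Sum.elim i j)
  · rw [if_pos h, Finset.sum_boole, ← Fintype.card_subtype, ← Nat.card_eq_fintype_card]
    have := card_middle p q i j h
    simp only [and_comm] at this ⊢
    rw [this, Nat.cast_pow]
  · rw [if_neg h]
    refine Finset.sum_eq_zero fun l _ => if_neg fun hl => h (comp_le_ker p q i j l hl.2 hl.1)

theorem toMat_mul (x y : PartitionAlgebra k N) :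
    toMat k N (x * y) = toMat k N x * toMat k N y := by
  have key : (PartitionAlgebra.mulBilin k N).compr₂ (toMat k N) =
      (LinearMap.mul ℂ _).compl₁₂ (toMat k N) (toMat k N) := by
    refine (PartitionAlgebra.diagramBasis k N).ext fun p =>
      (PartitionAlgebra.diagramBasis k N).ext fun q => ?_
    have h := mul_basis (N := N) p q
    change PartitionAlgebra.mulBilin k N _ _ = _ at h
    simp [h, toMat_basis, diagramMatrix_mul]
  exact LinearMap.congr_fun₂ key x y

theorem toMat_one : toMat k N 1 = 1 := by
  classical
  change toMat k N (PartitionAlgebra.diagramBasis k N (Diagram.one k)) = 1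
  ext j i
  rw [toMat_basis, diagramMatrix_apply, Matrix.one_apply]
  refine if_congr ⟨fun h => funext fun a => ?_, ?_⟩ rfl rfl
  · exact h (show Diagram.one k (Sum.inr a) (Sum.inl a) from rfl)
  · rintro rfl a b hab
    cases a <;> cases b <;> exact congrArg j hab

theorem toMat_transpose (x : PartitionAlgebra k N) :
    toMat k N (PartitionAlgebra.transpose k N x) = (toMat k N x)ᵀ := by
  classical
  have key : toMat k N ∘ₗ PartitionAlgebra.transpose k N =
      (Matrix.transposeLinearEquiv (Fin k → Fin N) (Fin k → Fin N) ℂ ℂ).toLinearMap ∘ₗ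
        toMat k N := by
    refine (PartitionAlgebra.diagramBasis k N).ext fun p => ?_
    ext j i
    simp only [LinearMap.comp_apply, transpose_basis, toMat_basis, LinearEquiv.coe_coe,
      Matrix.transposeLinearEquiv_apply, diagramMatrix_apply]
    refine if_congr ⟨fun h a b hab => ?_, fun h a b hab => ?_⟩ rfl rfl
    · have := @h a.swap b.swap (by
        rw [Setoid.comap_rel, Sum.swap_swap, Sum.swap_swap]; exact hab)
      cases a <;> cases b <;> exact this
    · have := @h a.swap b.swap hab
      cases a <;> cases b <;> exact this
  exact LinearMap.congr_fun key x

/-! ### Injectivity and the commutant of the symmetric group -/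

open Classical in
/-- The sums of coefficients over the diagrams that refine a given one. -/
def zeta (k N : ℕ) : PartitionAlgebra k N →ₗ[ℂ] (Diagram k → ℂ) :=
  (PartitionAlgebra.diagramBasis k N).constr ℂ fun p q => if p ≤ q then 1 else 0

open Classical in
theorem zeta_apply (d : PartitionAlgebra k N) (q : Diagram k) :
    zeta k N d q =
      ∑ p, if p ≤ q then (PartitionAlgebra.diagramBasis k N).repr d p else 0 := by
  rw [zeta, Module.Basis.constr_apply_fintype]
  simp [Module.Basis.equivFun_apply]

/-- Unitriangularity for refinement: once the coefficients of all strictly finer diagrams vanish,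
the value at `q` is the coefficient of `q`. -/
theorem zeta_injective : Function.Injective (zeta k N) := by
  classical
  rw [← LinearMap.ker_eq_bot, LinearMap.ker_eq_bot']
  intro d hd
  have h0 : ∀ q, (PartitionAlgebra.diagramBasis k N).repr d q = 0 := by
    intro q
    induction q using WellFoundedLT.induction with | _ q ih =>
    have h := congrFun hd q
    rw [zeta_apply, Finset.sum_eq_single q] at h
    · simpa using h
    · intro p _ hpq
      split_ifs with hle
      · exact ih p (lt_of_le_of_ne hle hpq)
      · rfl
    · simp
  exact (PartitionAlgebra.diagramBasis k N).repr.map_eq_zero_iff.1 (Finsupp.ext h0)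

theorem zeta_surjective : Function.Surjective (zeta k N) := by
  refine (LinearMap.injective_iff_surjective_of_finrank_eq_finrank ?_).1 zeta_injective
  rw [Module.finrank_eq_card_basis (PartitionAlgebra.diagramBasis k N),
    Module.finrank_fintype_fun_eq_card]

theorem toMat_apply (d : PartitionAlgebra k N) (j i : Fin k → Fin N) :
    toMat k N d j i = zeta k N d (Setoid.ker (Sum.elim i j)) := by
  classical
  have key : (LinearMap.proj i ∘ₗ LinearMap.proj j) ∘ₗ toMat k N =
      LinearMap.proj (Setoid.ker (Sum.elim i j)) ∘ₗ zeta k N := by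
    refine (PartitionAlgebra.diagramBasis k N).ext fun p => ?_
    rw [LinearMap.comp_apply, toMat_basis, LinearMap.comp_apply, zeta,
      Module.Basis.constr_basis]
    exact diagramMatrix_apply p j i
  exact LinearMap.congr_fun key d

/-- A partition of $2k$ vertices has at most $2k\le N$ blocks, so its blocks can receive distinct
labels. Every later use of `hN` goes back to this count. -/
theorem exists_ker_eq (hN : 2 * k ≤ N) (q : Diagram k) :
    ∃ i j : Fin k → Fin N, Setoid.ker (Sum.elim i j) = q := by
  classical
  have : Fintype (Quotient q) := Fintype.ofFinite _
  have hc : Fintype.card (Quotient q) ≤ Fintype.card (Fin N) := by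
    refine (Fintype.card_le_of_surjective (Quotient.mk q) Quotient.mk_surjective).trans ?_
    simp only [Fintype.card_sum, Fintype.card_fin]
    omega
  obtain ⟨e⟩ := Function.Embedding.nonempty_of_card_le hc
  refine ⟨fun a => e (Quotient.mk q (Sum.inl a)), fun a => e (Quotient.mk q (Sum.inr a)), ?_⟩
  have h : Sum.elim (fun a => e (Quotient.mk q (Sum.inl a)))
      (fun a => e (Quotient.mk q (Sum.inr a))) = fun x => e (Quotient.mk q x) := by
    funext x
    cases x <;> rfl
  rw [h]
  ext a b
  exact e.injective.eq_iff.trans Quotient.eq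

theorem toMat_injective (hN : 2 * k ≤ N) : Function.Injective (toMat k N) := by
  intro x y h
  refine zeta_injective (funext fun q => ?_)
  obtain ⟨i, j, rfl⟩ := exists_ker_eq hN q
  rw [← toMat_apply, ← toMat_apply, h]

/-- Equal kernels make $f(x)\mapsto g(x)$ a bijection between the ranges, which extends to a
permutation by finiteness. Thus $S_N$-orbits of labellings are classified by their kernels. -/
theorem exists_perm_of_ker_eq {X Y : Type*} [Finite Y] (f g : X → Y)
    (h : Setoid.ker f = Setoid.ker g) : ∃ σ : Equiv.Perm Y, σ ∘ f = g := by
  classical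
  have := Fintype.ofFinite Y
  let e : {y // y ∈ Set.range f} ≃ {y // y ∈ Set.range g} :=
    (Setoid.quotientKerEquivRange f).symm.trans
      ((Quotient.congrRight fun a b => by rw [h]).trans (Setoid.quotientKerEquivRange g))
  refine ⟨e.extendSubtype, funext fun x => ?_⟩
  rw [Function.comp_apply, e.extendSubtype_apply_of_mem _ ⟨x, rfl⟩]
  have : (Setoid.quotientKerEquivRange f).symm ⟨f x, x, rfl⟩ = Quotient.mk _ x := by
    rw [Equiv.symm_apply_eq]
    rfl
  simp only [e, Equiv.trans_apply]
  erw [this]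
  rfl

theorem exists_toMat_eq (X : Matrix (Fin k → Fin N) (Fin k → Fin N) ℂ)
    (hX : ∀ (σ : Equiv.Perm (Fin N)) j i, X (σ ∘ j) (σ ∘ i) = X j i) :
    ∃ d, toMat k N d = X := by
  classical
  have hdep : ∀ i j i' j' : Fin k → Fin N,
      Setoid.ker (Sum.elim i j) = Setoid.ker (Sum.elim i' j') → X j i = X j' i' := by
    intro i j i' j' h
    obtain ⟨σ, hσ⟩ := exists_perm_of_ker_eq _ _ h
    rw [← hX σ j i]
    exact congrArg₂ X (funext fun a => congrFun hσ (Sum.inr a))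
      (funext fun a => congrFun hσ (Sum.inl a))
  -- The value 0 is a dummy for partitions that are not kernels of labellings; no matrix entry sees
  -- it.
  obtain ⟨d, hd⟩ := zeta_surjective (k := k) (N := N) fun q =>
    if h : ∃ ij : (Fin k → Fin N) × (Fin k → Fin N), Setoid.ker (Sum.elim ij.1 ij.2) = q then
      X h.choose.2 h.choose.1 else 0
  refine ⟨d, ?_⟩
  ext j i
  have h : ∃ ij : (Fin k → Fin N) × (Fin k → Fin N),
    Setoid.ker (Sum.elim ij.1 ij.2) = Setoid.ker (Sum.elim i j) := ⟨(i, j), rfl⟩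
  rw [toMat_apply, hd]
  exact (dif_pos h).trans (hdep _ _ _ _ h.choose_spec)

theorem toMat_perm (d : PartitionAlgebra k N) (σ : Equiv.Perm (Fin N)) (j i : Fin k → Fin N) :
    toMat k N d (σ ∘ j) (σ ∘ i) = toMat k N d j i := by
  rw [toMat_apply, toMat_apply]
  refine congrArg _ (Setoid.ext fun a b => ?_)
  cases a <;> cases b <;> exact σ.injective.eq_iff

/-! ### The trace form and dual bases -/

theorem trace_toEnd_mul (x y : PartitionAlgebra k N) :
    LinearMap.trace ℂ (TensorSpace k N) (toEnd k N x * toEnd k N y) =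
      (toMat k N x * toMat k N y).trace := by
  rw [LinearMap.trace_eq_matrix_trace ℂ (tensorBasis k N), LinearMap.toMatrix_mul]
  rfl

theorem traceForm_apply (x y : PartitionAlgebra k N) :
    traceForm k N x y = (toMat k N x * (toMat k N y)ᵀ).trace := by
  change LinearMap.trace ℂ (TensorSpace k N)
    (toEnd k N x * transposeEnd k N (toEnd k N y)) = _
  rw [LinearMap.trace_eq_matrix_trace ℂ (tensorBasis k N), LinearMap.toMatrix_mul, transposeEnd]
  simp only [LinearMap.comp_apply, LinearEquiv.coe_coe, LinearMap.toMatrix_toLin]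
  rfl

theorem traceForm_comm (x y : PartitionAlgebra k N) :
    traceForm k N x y = traceForm k N y x := by
  rw [traceForm_apply, traceForm_apply, ← Matrix.trace_transpose, Matrix.transpose_mul,
    Matrix.transpose_transpose]

/-- Cyclicity of the trace; this adjointness later moves multiplication from `coeffElem` to the test
element. -/
theorem traceForm_mul_left (a x y : PartitionAlgebra k N) :
    traceForm k N (a * x) y = traceForm k N x (PartitionAlgebra.transpose k N a * y) := by
  rw [traceForm_apply, traceForm_apply, toMat_mul, toMat_mul, toMat_transpose,
    Matrix.transpose_mul, Matrix.transpose_transpose, Matrix.mul_assoc, Matrix.trace_mul_comm,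
    Matrix.mul_assoc]

theorem traceForm_mul_right (a x y : PartitionAlgebra k N) :
    traceForm k N (x * a) y = traceForm k N x (y * PartitionAlgebra.transpose k N a) := by
  rw [traceForm_apply, traceForm_apply, toMat_mul, toMat_mul, toMat_transpose,
    Matrix.transpose_mul, Matrix.transpose_transpose, Matrix.mul_assoc]

theorem transpose_transpose (x : PartitionAlgebra k N) :
    PartitionAlgebra.transpose k N (PartitionAlgebra.transpose k N x) = x := by
  have key : PartitionAlgebra.transpose k N ∘ₗ PartitionAlgebra.transpose k N =
      LinearMap.id := by
    refine (PartitionAlgebra.diagramBasis k N).ext fun p => ?_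
    rw [LinearMap.comp_apply, transpose_basis, transpose_basis, LinearMap.id_apply]
    congr 1
    ext a b
    simp only [Setoid.comap_rel, Sum.swap_swap]
  exact LinearMap.congr_fun key x

open scoped ComplexOrder in
theorem traceForm_separating (hN : 2 * k ≤ N) (x : PartitionAlgebra k N)
    (h : ∀ y, traceForm k N x y = 0) : x = 0 := by
  -- The entrywise conjugate of $X$ is again permutation invariant, so it comes from some $y$, and
  -- $\langle x,y\rangle=\operatorname{Tr}(XX^*)$.
  obtain ⟨y, hy⟩ := exists_toMat_eq (k := k) (N := N) ((toMat k N x)ᴴᵀ) fun σ j i => by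
    simp only [Matrix.transpose_apply, Matrix.conjTranspose_apply, toMat_perm]
  have h1 := h y
  rw [traceForm_apply, hy, Matrix.transpose_transpose,
    Matrix.trace_mul_conjTranspose_self_eq_zero_iff] at h1
  exact toMat_injective hN (h1.trans (map_zero _).symm)

theorem traceForm_nondegenerate (hN : 2 * k ≤ N) : (traceForm k N).Nondegenerate :=
  ⟨traceForm_separating hN, fun y h => traceForm_separating hN y fun x => by
    rw [traceForm_comm, h]⟩

theorem eq_of_traceForm_eq (hN : 2 * k ≤ N) {x y : PartitionAlgebra k N}
    (h : ∀ z, traceForm k N z x = traceForm k N z y) : x = y := by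
  refine sub_eq_zero.1 (traceForm_separating hN _ fun z => ?_)
  rw [traceForm_comm, map_sub, h, sub_self]

section Dual

theorem gram_apply {ι : Type*} (b : Module.Basis ι ℂ (PartitionAlgebra k N)) (i j : ι) :
    gram b i j = traceForm k N (b i) (PartitionAlgebra.transpose k N (b j)) := by
  rw [gram, Matrix.of_apply, trace_toEnd_mul, traceForm_apply, toMat_transpose,
    Matrix.transpose_transpose]

variable {ι : Type*} [Fintype ι] [DecidableEq ι] (b : Module.Basis ι ℂ (PartitionAlgebra k N))

/-- A left null vector of the Gram matrix gives a combination of the `b i` orthogonal to every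
transpose of a basis element, hence to everything, as transposition is an involution. -/
theorem isUnit_det_gram (hN : 2 * k ≤ N) : IsUnit (gram b).det := by
  rw [isUnit_iff_ne_zero]
  intro h0
  obtain ⟨v, hv, hv0⟩ := Matrix.exists_vecMul_eq_zero_iff.2 h0
  have hx : ∑ i, v i • b i = 0 := by
    refine traceForm_separating hN _ fun y => ?_
    have hlin : traceForm k N (∑ i, v i • b i) ∘ₗ PartitionAlgebra.transpose k N = 0 := by
      refine b.ext fun j => ?_
      have := congrFun hv0 j
      simpa [Matrix.vecMul, dotProduct, gram_apply, LinearMap.sum_apply] using this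
    have := LinearMap.congr_fun hlin (PartitionAlgebra.transpose k N y)
    rwa [LinearMap.comp_apply, transpose_transpose] at this
  exact hv (funext fun i => Fintype.linearIndependent_iff.1 b.linearIndependent v hx i)

theorem traceForm_dual (hN : 2 * k ≤ N) (i j : ι) :
    traceForm k N (b i) (dual b j) = if i = j then 1 else 0 := by
  have h := congrFun (congrFun (Matrix.mul_nonsing_inv (gram b) (isUnit_det_gram b hN)) i) j
  rw [Matrix.mul_apply, Matrix.one_apply] at h
  rw [← h, dual, map_sum]
  refine Finset.sum_congr rfl fun l _ => ?_
  rw [map_smul, gram_apply, smul_eq_mul, mul_comm]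

/-- The element of `P_k(N)` representing the matrix coefficient `D_{αβ}` for the trace form. -/
def coeffElem (D : MatrixRep k N m) (α β : Fin m) : PartitionAlgebra k N :=
  ∑ i, D (b i) α β • dual b i

variable {b}

theorem traceForm_coeffElem (hN : 2 * k ≤ N) (D : MatrixRep k N m) (α β : Fin m)
    (x : PartitionAlgebra k N) : traceForm k N x (coeffElem b D α β) = D x α β := by
  have key : (traceForm k N).flip (coeffElem b D α β) =
      Matrix.entryLinearMap ℂ ℂ α β ∘ₗ D.toLin := by
    refine b.ext fun j => ?_
    change traceForm k N (b j) (coeffElem b D α β) = _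
    rw [coeffElem, map_sum]
    simp only [map_smul, traceForm_dual b hN, smul_eq_mul, mul_ite, mul_one, mul_zero,
      Finset.sum_ite_eq, Finset.mem_univ, if_true]
    rfl
  exact LinearMap.congr_fun key x

theorem apply_coeffElem (D : MatrixRep k N m) (D' : MatrixRep k N m') (α β : Fin m)
    (ρ σ : Fin m') :
    D' (coeffElem b D α β) ρ σ = ∑ i, D (b i) α β * D' (dual b i) ρ σ := by
  rw [coeffElem, map_sum, Matrix.sum_apply]
  simp

/-- Pairing with $z$ gives $\langle z,aE_{\alpha\beta}\rangle=\langle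
a^Tz,E_{\alpha\beta}\rangle=(D(a)^TD(z))_{\alpha\beta}$; orthogonality of `D` enters in the last
equality. -/
theorem mul_coeffElem (hN : 2 * k ≤ N) (D : MatrixRep k N m) (hD : D.IsOrthogonal)
    (a : PartitionAlgebra k N) (α β : Fin m) :
    a * coeffElem b D α β = ∑ γ, D a γ α • coeffElem b D γ β := by
  refine eq_of_traceForm_eq hN fun z => ?_
  have h := traceForm_mul_left (PartitionAlgebra.transpose k N a) z (coeffElem b D α β)
  rw [transpose_transpose, traceForm_coeffElem hN, D.map_mul, hD, Matrix.mul_apply] at h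
  rw [← h, map_sum]
  simp only [map_smul, traceForm_coeffElem hN, smul_eq_mul, Matrix.transpose_apply]

theorem coeffElem_mul (hN : 2 * k ≤ N) (D : MatrixRep k N m) (hD : D.IsOrthogonal)
    (a : PartitionAlgebra k N) (α β : Fin m) :
    coeffElem b D α β * a = ∑ γ, D a β γ • coeffElem b D α γ := by
  refine eq_of_traceForm_eq hN fun z => ?_
  have h := traceForm_mul_right (PartitionAlgebra.transpose k N a) z (coeffElem b D α β)
  rw [transpose_transpose, traceForm_coeffElem hN, D.map_mul, hD, Matrix.mul_apply] at h
  rw [← h, map_sum]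
  simp only [map_smul, traceForm_coeffElem hN, smul_eq_mul, Matrix.transpose_apply, mul_comm]

end Dual

/-! ### Schur's lemma -/

namespace MatrixRep

theorem IsIrreducible.eq_zero_of_mulVec {D : MatrixRep k N m} {n : ℕ} {D' : MatrixRep k N n}
    (hD : D.IsIrreducible)
    (F : Matrix (Fin n) (Fin m) ℂ) (hF : ∀ a, D' a * F = F * D a) (v : Fin m → ℂ) (hv : v ≠ 0)
    (hv0 : F *ᵥ v = 0) : F = 0 := by
  rcases hD.2 (LinearMap.ker F.mulVecLin) (fun d w hw => by
    rw [LinearMap.mem_ker, Matrix.mulVecLin_apply] at hw ⊢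
    rw [Matrix.mulVec_mulVec, ← hF, ← Matrix.mulVec_mulVec, hw, Matrix.mulVec_zero]) with h | h
  · exact absurd ((Submodule.eq_bot_iff _).1 h v hv0) hv
  · exact Matrix.ext_iff_mulVec.2 fun w => by
      have : w ∈ LinearMap.ker F.mulVecLin := h ▸ Submodule.mem_top
      simpa using this

theorem IsIrreducible.intertwiner_eq_zero {D : MatrixRep k N m} {D' : MatrixRep k N m'}
    (hD : D.IsIrreducible) (hD' : D'.IsIrreducible) (hne : ¬ D.Isomorphic D')
    (F : Matrix (Fin m') (Fin m) ℂ) (hF : ∀ a, D' a * F = F * D a) : F = 0 := by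
  by_contra h0
  have hinj : Function.Injective F.mulVecLin := by
    rw [← LinearMap.ker_eq_bot, LinearMap.ker_eq_bot']
    intro v hv
    by_contra hv0
    exact h0 (hD.eq_zero_of_mulVec F hF v hv0 hv)
  have hsurj : Function.Surjective F.mulVecLin := by
    rw [← LinearMap.range_eq_top]
    refine (hD'.2 (LinearMap.range F.mulVecLin) ?_).resolve_left fun h => h0 ?_
    · rintro d _ ⟨w, rfl⟩
      refine ⟨D d *ᵥ w, ?_⟩
      rw [Matrix.mulVecLin_apply, Matrix.mulVecLin_apply, Matrix.mulVec_mulVec,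
        Matrix.mulVec_mulVec, hF]
    · rw [LinearMap.range_eq_bot] at h
      exact Matrix.ext_iff_mulVec.2 fun w => by simpa using LinearMap.congr_fun h w
  have hbij : Function.Bijective F.mulVecLin := ⟨hinj, hsurj⟩
  refine hne ⟨LinearEquiv.ofBijective F.mulVecLin hbij, fun d v => ?_⟩
  simp only [LinearEquiv.ofBijective_apply, Matrix.mulVecLin_apply, Matrix.mulVec_mulVec, hF]

theorem IsIrreducible.intertwiner_eq_smul_one {D : MatrixRep k N m} (hD : D.IsIrreducible)
    (F : Matrix (Fin m) (Fin m) ℂ) (hF : ∀ a, D a * F = F * D a) :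
    ∃ c : ℂ, F = c • (1 : Matrix (Fin m) (Fin m) ℂ) := by
  have : Nonempty (Fin m) := ⟨⟨0, hD.1⟩⟩
  obtain ⟨c, hc⟩ := Module.End.exists_eigenvalue F.mulVecLin
  obtain ⟨v, hv⟩ := hc.exists_hasEigenvector
  refine ⟨c, sub_eq_zero.1 (hD.eq_zero_of_mulVec (D' := D) _ (fun a => ?_) v hv.2 ?_)⟩
  · rw [mul_sub, sub_mul, hF]
    simp
  · have := hv.apply_eq_smul
    rw [Matrix.mulVecLin_apply] at this
    rw [Matrix.sub_mulVec, this, Matrix.smul_mulVec, Matrix.one_mulVec, sub_self]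

end MatrixRep

/-! ### Orthogonality of matrix coefficients -/

section Orthogonality

variable {ι : Type*} [Fintype ι] [DecidableEq ι] {b : Module.Basis ι ℂ (PartitionAlgebra k N)}

/-- With $\beta,\sigma$ fixed, this is `mul_coeffElem` read through the $(\rho,\sigma)$ entry of
`D'`. It prepares Schur's lemma in the indices $\alpha,\rho$. -/
theorem coeffElem_intertwines (hN : 2 * k ≤ N) (D : MatrixRep k N m) (hD : D.IsOrthogonal)
    (D' : MatrixRep k N m') (β : Fin m) (σ : Fin m') (a : PartitionAlgebra k N) :
    D' a * (Matrix.of fun ρ α => D' (coeffElem b D α β) ρ σ) =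
      (Matrix.of fun ρ α => D' (coeffElem b D α β) ρ σ) * D a := by
  ext ρ α
  have h := congrArg (fun x => D' x ρ σ) (mul_coeffElem (b := b) hN D hD a α β)
  simp only [D'.map_mul, Matrix.mul_apply, map_sum, map_smul, Matrix.sum_apply,
    Matrix.smul_apply, smul_eq_mul] at h
  simp only [Matrix.mul_apply, Matrix.of_apply, h, mul_comm]

theorem orthogonality_of_not_isomorphic (hN : 2 * k ≤ N) (D : MatrixRep k N m)
    (hD : D.IsOrthogonal) (D' : MatrixRep k N m') (hirr : D.IsIrreducible)
    (hirr' : D'.IsIrreducible) (hne : ¬ D.Isomorphic D') (α β : Fin m) (ρ σ : Fin m') :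
    D' (coeffElem b D α β) ρ σ = 0 :=
  congrFun (congrFun (hirr.intertwiner_eq_zero hirr' hne _
    (coeffElem_intertwines (b := b) hN D hD D' β σ)) ρ) α

theorem exists_orthogonality (hN : 2 * k ≤ N) (D : MatrixRep k N m) (hD : D.IsOrthogonal)
    (hirr : D.IsIrreducible) : ∃ c : ℂ, ∀ α β ρ σ : Fin m,
      D (coeffElem b D α β) ρ σ = if α = ρ ∧ β = σ then c else 0 := by
  choose c hc using fun β σ => hirr.intertwiner_eq_smul_one _
    (coeffElem_intertwines (b := b) hN D hD D β σ)
  have hc' : ∀ α β ρ σ, D (coeffElem b D α β) ρ σ = if α = ρ then c β σ else 0 := by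
    intro α β ρ σ
    have := congrFun (congrFun (hc β σ) ρ) α
    simpa [Matrix.one_apply, eq_comm] using this
  -- The scalars left by the first use of Schur's lemma form a matrix in $\beta,\sigma$; right
  -- multiplication shows that it commutes with every $D(a)$.
  obtain ⟨c₀, hc₀⟩ := hirr.intertwiner_eq_smul_one (Matrix.of c) fun a => by
    ext β σ
    -- Any row index serves here; `β` only witnesses that one exists.
    have α : Fin m := β
    have h := congrArg (fun x => D x α σ) (coeffElem_mul (b := b) hN D hD a α β)
    simp only [D.map_mul, Matrix.mul_apply, map_sum, map_smul, Matrix.sum_apply,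
      Matrix.smul_apply, smul_eq_mul, hc', if_true] at h
    simpa only [Matrix.mul_apply, Matrix.of_apply] using h.symm
  refine ⟨c₀, fun α β ρ σ => ?_⟩
  have h : c β σ = if β = σ then c₀ else 0 := by
    simpa [Matrix.one_apply] using congrFun (congrFun hc₀ β) σ
  rw [hc', h, ite_and]

end Orthogonality

theorem toEnd_mul (x y : PartitionAlgebra k N) :
    toEnd k N (x * y) = toEnd k N x * toEnd k N y := by
  rw [← toLin_toMat, toMat_mul, Matrix.toLin_mul _ (tensorBasis k N), toLin_toMat, toLin_toMat]
  rfl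

theorem trace_toEnd (x : PartitionAlgebra k N) :
    LinearMap.trace ℂ (TensorSpace k N) (toEnd k N x) = traceForm k N 1 x := by
  rw [traceForm_apply, toMat_one, one_mul, Matrix.trace_transpose,
    LinearMap.trace_eq_matrix_trace ℂ (tensorBasis k N)]
  rfl

/-! ### The dimension of the partner -/

section Dimension

variable {ι : Type*} [Fintype ι] [DecidableEq ι] {b : Module.Basis ι ℂ (PartitionAlgebra k N)}

/-- The kernel of `f - g` is invariant and contains `z ≠ 0`, so it is everything. Hence evaluation
at a nonzero vector embeds $V_\lambda$ in $V_N^{\otimes k}$. -/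
theorem partner_eq_of_apply_eq {D : MatrixRep k N m} (hirr : D.IsIrreducible)
    {f g : (Fin m → ℂ) →ₗ[ℂ] TensorSpace k N} (hf : f ∈ partner D) (hg : g ∈ partner D)
    {z : Fin m → ℂ} (hz : z ≠ 0) (h : f z = g z) : f = g := by
  rw [← sub_eq_zero]
  rcases hirr.2 (LinearMap.ker (f - g)) (fun d w hw => by
    have hfg := (partner D).sub_mem hf hg d w
    rw [LinearMap.mem_ker] at hw ⊢
    rw [hfg, hw, map_zero]) with h0 | h0
  · refine absurd ((Submodule.eq_bot_iff _).1 h0 z ?_) hz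
    rw [LinearMap.mem_ker, LinearMap.sub_apply, h, sub_self]
  · exact LinearMap.ker_eq_top.1 h0

variable (b) in
/-- The intertwiner sending the `α`-th basis vector to `E_{αα} v`, up to a scalar. -/
def coeffHom (D : MatrixRep k N m) (α : Fin m) (v : TensorSpace k N) :
    (Fin m → ℂ) →ₗ[ℂ] TensorSpace k N :=
  ∑ γ, (LinearMap.proj γ : (Fin m → ℂ) →ₗ[ℂ] ℂ).smulRight
    (toEnd k N (coeffElem b D γ α) v)

theorem coeffHom_apply (D : MatrixRep k N m) (α : Fin m) (v : TensorSpace k N)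
    (w : Fin m → ℂ) :
    coeffHom b D α v w = ∑ γ, w γ • toEnd k N (coeffElem b D γ α) v := by
  simp [coeffHom, LinearMap.sum_apply]

theorem coeffHom_mem (hN : 2 * k ≤ N) (D : MatrixRep k N m) (hD : D.IsOrthogonal)
    (α : Fin m) (v : TensorSpace k N) : coeffHom b D α v ∈ partner D := by
  intro a w
  simp only [coeffHom_apply, map_sum, map_smul, ← Module.End.mul_apply, ← toEnd_mul,
    mul_coeffElem hN D hD, LinearMap.sum_apply, LinearMap.smul_apply, Finset.smul_sum,
    Matrix.mulVec, dotProduct, Finset.sum_smul, smul_smul]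
  rw [Finset.sum_comm]
  simp only [mul_comm]

theorem coeff_mul_finrank_partner (hN : 2 * k ≤ N) (D : MatrixRep k N m) (hD : D.IsOrthogonal)
    (hirr : D.IsIrreducible) (c : ℂ)
    (hc : ∀ α β ρ σ : Fin m,
      D (coeffElem b D α β) ρ σ = if α = ρ ∧ β = σ then c else 0) :
    c * (Module.finrank ℂ (partner D) : ℂ) = 1 := by
  let α : Fin m := ⟨0, hirr.1⟩
  set E := toEnd k N (coeffElem b D α α) with hE
  have htr : LinearMap.trace ℂ _ E = 1 := by
    rw [hE, trace_toEnd, traceForm_coeffElem hN, D.map_one, Matrix.one_apply_eq]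
  have hEE : E * E = c • E := by
    rw [hE, ← toEnd_mul, mul_coeffElem hN D hD, map_sum, Finset.sum_eq_single α]
    · rw [hc, if_pos ⟨rfl, rfl⟩, map_smul]
    · intro γ _ h
      rw [hc, if_neg fun h' => h h'.1.symm, zero_smul, map_zero]
    · simp
  -- If $c=0$ then $E^2=0$, and a nilpotent map cannot have trace 1.
  have hc0 : c ≠ 0 := by
    rintro rfl
    have hnil : IsNilpotent E := ⟨2, by rw [pow_two, hEE, zero_smul]⟩
    have := (LinearMap.isNilpotent_trace_of_isNilpotent hnil).eq_zero
    rw [htr] at this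
    exact one_ne_zero this
  set P := c⁻¹ • E with hP
  have hPP : P * P = P := by
    rw [hP, smul_mul_smul_comm, hEE, smul_smul, mul_assoc, inv_mul_cancel₀ hc0, mul_one]
  have hproj : LinearMap.IsProj (LinearMap.range P) P :=
    ⟨fun x => LinearMap.mem_range_self P x, by
      rintro _ ⟨y, rfl⟩
      exact LinearMap.congr_fun hPP y⟩
  have hrank := hproj.trace
  rw [hP, map_smul, htr, smul_eq_mul, mul_one, ← hP] at hrank
  have hz : (Pi.single α 1 : Fin m → ℂ) ≠ 0 := by simp
  -- By `hc`, $D(E_{\alpha\alpha})e_\alpha=c\,e_\alpha$, and `f` intertwines.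
  have hfix : ∀ f ∈ partner D, P (f (Pi.single α 1)) = f (Pi.single α 1) := by
    intro f hf
    rw [hP, LinearMap.smul_apply, hE, ← hf, ← map_smul]
    congr 1
    ext ρ
    by_cases h : α = ρ
    · subst h
      simp [hc, hc0]
    · simp [hc, h, Ne.symm h]
  have hfin : Module.finrank ℂ (partner D) = Module.finrank ℂ (LinearMap.range P) := by
    let ev : partner D →ₗ[ℂ] LinearMap.range P :=
      LinearMap.codRestrict _ ((LinearMap.applyₗ (Pi.single α 1)) ∘ₗ (partner D).subtype)
        fun f => ⟨f.1 (Pi.single α 1), hfix f.1 f.2⟩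
    have hev : ∀ f, (ev f : TensorSpace k N) = f.1 (Pi.single α 1) := fun f => rfl
    refine (LinearEquiv.ofBijective ev ⟨fun f g h => ?_, fun v => ?_⟩).finrank_eq
    · exact Subtype.ext (partner_eq_of_apply_eq hirr f.2 g.2 hz (congrArg Subtype.val h))
    -- At $e_\alpha$ this intertwiner takes the value $c^{-1}E_{\alpha\alpha}v=Pv$, which is $v$ on
    -- the range of $P$.
    · refine ⟨c⁻¹ • ⟨coeffHom b D α v, coeffHom_mem hN D hD α v⟩, Subtype.ext ?_⟩
      rw [map_smul, Submodule.coe_smul, hev, coeffHom_apply,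
        Finset.sum_eq_single α (fun γ _ h => by simp [h]) (by simp), Pi.single_eq_same, one_smul]
      exact hproj.map_id v v.2
  rw [hfin, ← hrank, mul_inv_cancel₀ hc0]

end Dimension

/-! ### Irreducibility of the partner -/

/-- Maschke's argument: a linear projection onto `U` is averaged over its conjugates by the group.
-/
theorem exists_equivariant_projection {G V : Type*} [Group G] [Finite G] [AddCommGroup V]
    [Module ℂ V] (ρ : Representation ℂ G V) (U : Submodule ℂ V)
    (hU : ∀ g, ∀ u ∈ U, ρ g u ∈ U) :
    ∃ P : V →ₗ[ℂ] V, (∀ g, P ∘ₗ ρ g = ρ g ∘ₗ P) ∧ LinearMap.IsProj U P := by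
  classical
  have := Fintype.ofFinite G
  obtain ⟨p, hp⟩ := LinearMap.exists_leftInverse_of_injective U.subtype U.ker_subtype
  have hpU : ∀ u (hu : u ∈ U), (p u : V) = u := fun u hu =>
    congrArg Subtype.val (LinearMap.congr_fun hp ⟨u, hu⟩)
  have hcard : (Fintype.card G : ℂ) ≠ 0 := Nat.cast_ne_zero.2 Fintype.card_ne_zero
  let S : V →ₗ[ℂ] V := ∑ g : G, ρ g ∘ₗ (U.subtype ∘ₗ p) ∘ₗ ρ g⁻¹
  have hS : ∀ v, S v = ∑ g : G, ρ g (p (ρ g⁻¹ v)) := fun v => by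
    simp [S, LinearMap.sum_apply]
  refine ⟨(Fintype.card G : ℂ)⁻¹ • S, fun h => LinearMap.ext fun v => ?_,
    fun v => U.smul_mem _ ?_, fun u hu => ?_⟩
  · simp only [LinearMap.comp_apply, LinearMap.smul_apply, hS, map_smul, map_sum]
    congr 1
    rw [← Equiv.sum_comp (Equiv.mulLeft h)]
    refine Finset.sum_congr rfl fun g _ => ?_
    simp only [Equiv.coe_mulLeft, _root_.mul_inv_rev, map_mul, Module.End.mul_apply]
    rw [← Module.End.mul_apply (ρ h⁻¹), ← map_mul, inv_mul_cancel, map_one,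
      Module.End.one_apply]
  · rw [hS]
    exact U.sum_mem fun g _ => hU g _ (p _).2
  · rw [LinearMap.smul_apply, hS, Finset.sum_congr rfl fun g _ => ?_, Finset.sum_const,
      Finset.card_univ, ← Nat.cast_smul_eq_nsmul ℂ, smul_smul, inv_mul_cancel₀ hcard, one_smul]
    rw [hpU _ (hU _ _ hu), ← Module.End.mul_apply, ← map_mul, mul_inv_cancel, map_one,
      Module.End.one_apply]

/-- Commuting with $S_N$ means that the matrix is invariant under simultaneous relabelling of rows
and columns, so `exists_toMat_eq` applies. -/
theorem exists_toEnd_eq (P : TensorSpace k N →ₗ[ℂ] TensorSpace k N)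
    (hP : ∀ σ : Equiv.Perm (Fin N), P ∘ₗ permRep k N σ = permRep k N σ ∘ₗ P) :
    ∃ d, toEnd k N d = P := by
  obtain ⟨d, hd⟩ := exists_toMat_eq
    (LinearMap.toMatrix (tensorBasis k N) (tensorBasis k N) P) fun σ j i => by
    rw [LinearMap.toMatrix_apply, LinearMap.toMatrix_apply, ← permRep_tensorBasis]
    have h := LinearMap.congr_fun (hP σ) (tensorBasis k N i)
    rw [LinearMap.comp_apply, LinearMap.comp_apply] at h
    rw [h]
    generalize P (tensorBasis k N i) = v
    have key : (tensorBasis k N).coord (σ ∘ j) ∘ₗ permRep k N σ = (tensorBasis k N).coord j := by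
      refine (tensorBasis k N).ext fun l => ?_
      simp only [LinearMap.comp_apply, permRep_tensorBasis, Module.Basis.coord_apply,
        Module.Basis.repr_self, Finsupp.single_apply, σ.injective.comp_left.eq_iff]
    exact LinearMap.congr_fun key v
  exact ⟨d, by rw [← toLin_toMat, hd, Matrix.toLin_toMatrix]⟩

/-- The values at $z$ of the members of $W$ form an $S_N$-stable subspace, whose equivariant
projection is the action of some $d$. Injectivity of a nonzero $f\in W$ forces $D(d)z=z$. Then
$g(z)=g(D(d)z)$ lies in that subspace, so $g$ agrees at $z$ with a member of $W$ and equals it. -/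
theorem partner_mem_of_subrepresentation {D : MatrixRep k N m}
    (hirr : D.IsIrreducible) (W : Subrepresentation (partnerRep D)) (f g : partner D)
    (hf : f ∈ W.toSubmodule) (hf0 : f ≠ 0) : g ∈ W.toSubmodule := by
  have : Nonempty (Fin m) := ⟨⟨0, hirr.1⟩⟩
  obtain ⟨z, hz⟩ := exists_ne (0 : Fin m → ℂ)
  obtain ⟨P, hPcomm, hP⟩ := exists_equivariant_projection (permRep k N)
    (W.toSubmodule.map ((LinearMap.applyₗ z) ∘ₗ (partner D).subtype)) (by
      rintro σ _ ⟨h, hh, rfl⟩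
      exact ⟨partnerRep D σ h, W.apply_mem_toSubmodule σ hh, rfl⟩)
  obtain ⟨d, rfl⟩ := exists_toEnd_eq P hPcomm
  have hdz : D d *ᵥ z = z := by
    by_contra hne
    refine hf0 (Subtype.ext (partner_eq_of_apply_eq hirr f.2 (partner D).zero_mem
      (sub_ne_zero.2 hne) ?_))
    rw [map_sub, f.2, show toEnd k N d (f.1 z) = f.1 z from hP.map_id _ ⟨f, hf, rfl⟩,
      sub_self]
    rfl
  obtain ⟨h, hh, hhz⟩ := hP.map_mem (g.1 z)
  rw [← g.2, hdz] at hhz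
  have : h = g := Subtype.ext (partner_eq_of_apply_eq hirr h.2 g.2 hz hhz)
  exact this ▸ hh

theorem partnerRep_isIrreducible {D : MatrixRep k N m}
    (hirr : D.IsIrreducible) (hpos : Module.finrank ℂ (partner D) ≠ 0) :
    (partnerRep D).IsIrreducible := by
  have hnt : Nontrivial (partner D) :=
    Module.nontrivial_of_finrank_pos (R := ℂ) (Nat.pos_of_ne_zero hpos)
  obtain ⟨g, hg⟩ := exists_ne (0 : partner D)
  refine { exists_pair_ne := ⟨⊥, ⊤, fun h => hg ?_⟩, eq_bot_or_eq_top := fun W => ?_ }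
  · have : g ∈ (⊤ : Subrepresentation (partnerRep D)).toSubmodule := Submodule.mem_top
    rw [← h] at this
    exact (Submodule.mem_bot ℂ).1 this
  · by_cases hW : ∃ f ∈ W.toSubmodule, f ≠ 0
    · obtain ⟨f, hf, hf0⟩ := hW
      exact Or.inr (Subrepresentation.toSubmodule_injective (Submodule.eq_top_iff'.2 fun g =>
        partner_mem_of_subrepresentation hirr W f g hf hf0))
    · push Not at hW
      exact Or.inl (Subrepresentation.toSubmodule_injective ((Submodule.eq_bot_iff _).2 hW))

end PartitionAlg

end

open PartitionAlg in
theorem mainTheorem3 (k N : ℕ) (hN : 2 * k ≤ N)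
    {ι : Type*} [Fintype ι] [DecidableEq ι] (b : Module.Basis ι ℂ (PartitionAlgebra k N))
    {Λ : Type*} (m : Λ → ℕ) (D : ∀ l : Λ, MatrixRep k N (m l))
    (hirr : ∀ l, (D l).IsIrreducible)
    (horth : ∀ l, (D l).IsOrthogonal)
    (hpair : ∀ l l', l ≠ l' → ¬ (D l).Isomorphic (D l')) :
    (traceForm k N).Nondegenerate ∧
    (∀ i j, traceForm k N (b i) (dual b j) = if i = j then 1 else 0) ∧
    (∀ l, (partnerRep (D l)).IsIrreducible) ∧
    (∀ (l : Λ) (α β ρ σ : Fin (m l)),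
      ∑ i, D l (b i) α β * D l (dual b i) ρ σ =
        if α = ρ ∧ β = σ then 1 / (Module.finrank ℂ (partner (D l)) : ℂ) else 0) ∧
    (∀ (l l' : Λ), l ≠ l' → ∀ (α β : Fin (m l)) (ρ σ : Fin (m l')),
      ∑ i, D l (b i) α β * D l' (dual b i) ρ σ = 0) := by
  have hdim : ∀ l, ∃ c : ℂ, (∀ α β ρ σ, D l (coeffElem b (D l) α β) ρ σ =
      if α = ρ ∧ β = σ then c else 0) ∧ c * (Module.finrank ℂ (partner (D l)) : ℂ) = 1 := by
    intro l
    obtain ⟨c, hc⟩ := exists_orthogonality (b := b) hN (D l) (horth l) (hirr l)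
    exact ⟨c, hc, coeff_mul_finrank_partner hN (D l) (horth l) (hirr l) c hc⟩
  refine ⟨traceForm_nondegenerate hN, traceForm_dual b hN, fun l => ?_, fun l α β ρ σ => ?_,
    fun l l' hne α β ρ σ => ?_⟩
  -- Irreducibility includes $V_\lambda\ne 0$, which follows from $c\dim V_\lambda=1$.
  · obtain ⟨c, -, hc⟩ := hdim l
    refine partnerRep_isIrreducible (hirr l) fun h0 => ?_
    rw [h0, Nat.cast_zero, mul_zero] at hc
    exact zero_ne_one hc
  · obtain ⟨c, hc, hc1⟩ := hdim l
    rw [← apply_coeffElem, hc, eq_one_div_of_mul_eq_one_left hc1]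
  · rw [← apply_coeffElem]
    exact orthogonality_of_not_isomorphic hN (D l) (horth l) (D l') (hirr l) (hirr l')
      (hpair l l' hne) α β ρ σ
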